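/- Let $p\ge 3$ be a prime. For $x\in\mathbb{F}_p^n$ and $a\in\mathbb{F}_p$ let $w_a(x):=|\{i\in\{1,\dots,n\}:x_i=a\}|$. Call $S\subseteq\mathbb{F}_p^n$ \emph{symmetric} if membership $x\in S$ depends only on the weights $(w_0(x),\dots,w_{p-1}(x))$ (equivalently, $S$ is invariant under permutations of coordinates). The \emph{density} of $S$ is $|S|/p^n$. Let $X^{(1)},\dots,X^{(p)}$ be a uniformly random arithmetic progression of length $p$ in $\mathbb{F}_p^n$, i.e. $X^{(j)}=x+(j-1)d$ with $x,d\in\mathbb{F}_p^n$ independent and uniform. There exists a constant $C>0$, depending only on $p$, such that for every $0<\mu<1$ there exists $n_0=n_0(p,\mu)$ such that for all $n\ge n_0$ the following two statements hold. (1) If $S^{(1)},\dots,S^{(p)}\subseteq\mathbb{F}_p^n$ are symmetric sets satisfying $$\Pr\left[X^{(1)}\in S^{(1)}\land\dots\land X^{(p)}\in S^{(p)}\right]<\mu^C,$$ then there exist symmetric sets $S'^{(1)},\dots,S'^{(p)}\subseteq\mathbb{F}_p^n$, each of density at most $\mu$, such that, letting $T^{(j)}:=S^{(j)}\setminus S'^{(j)}$,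 $$\Pr\left[X^{(1)}\in T^{(1)}\land\dots\land X^{(p)}\in T^{(p)}\right]=0.$$ (2) Every symmetric set $S\subseteq\mathbb{F}_p^n$ of density at least $\mu$ contains at least $(\mu/p)^C\cdot p^{2n}$ arithmetic progressions $x,x+d,\dots,x+(p-1)d$ of length $p$, where $x,d\in\mathbb{F}_p^n$ and the degenerate progressions with $d=0$ are counted. -/

import Mathlib

/-- The weight `w_a(x)`: the number of coordinates of `x ∈ 𝔽_p^n` that are equal to `a`. -/
def weight {p n : ℕ} (a : ZMod p) (x : Fin n → ZMod p) : ℕ :=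
  (Finset.univ.filter fun i : Fin n => x i = a).card

/-- A set `S ⊆ 𝔽_p^n` is symmetric if membership `x ∈ S` depends only on the weight tuple
`(w_0(x), …, w_{p-1}(x))`. -/
def SymmetricSet {p n : ℕ} (S : Finset (Fin n → ZMod p)) : Prop :=
  ∀ x y : Fin n → ZMod p, (∀ a : ZMod p, weight a x = weight a y) → (x ∈ S ↔ y ∈ S)

/-- The progressions `x, x + d, …, x + (p - 1) d` of length `p` in `𝔽_p^n` (the degenerate ones
with `d = 0` included), given by their pairs `(x, d)`, whose `j`-th term `x + j d` lies in `S j`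
for every `j = 0, …, p - 1`. For `p ≥ 2` the pair `(x, d)` is determined by the progression. -/
def progressionsIn {p n : ℕ} [NeZero p] (S : Fin p → Finset (Fin n → ZMod p)) :
    Finset ((Fin n → ZMod p) × (Fin n → ZMod p)) :=
  Finset.univ.filter fun z => ∀ j : Fin p, z.1 + (j : ℕ) • z.2 ∈ S j

/-- The probability that a uniformly random progression of length `p` in `𝔽_p^n` (that is, with
`x` and `d` independent and uniform) has its `j`-th term in `S j` for every `j`. It is the number
of such pairs `(x, d)` divided by the number `p ^ (2 n)` of all pairs. -/
noncomputable def progressionProb {p n : ℕ} [NeZero p] (S : Fin p → Finset (Fin n → ZMod p)) : ℝ :=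
  ((progressionsIn S).card : ℝ) / (p : ℝ) ^ (2 * n)

/-- The density `|S| / p^n` of a set `S ⊆ 𝔽_p^n`. -/
noncomputable def density {p n : ℕ} (S : Finset (Fin n → ZMod p)) : ℝ :=
  (S.card : ℝ) / (p : ℝ) ^ n

/-! A symmetric set amounts to a set of weight tuples. A pair (x, d) of vectors is a word over 𝔽_p ×
𝔽_p. Its number of letters (x, d) is a multiplicity on the line a = x + j d in the plane of points
(j, a), and the weight of a in the j-th term is the sum of the multiplicities over the non-vertical
lines through (j, a). Counting progressions thus means inverting this transform over the integers.

The inversion (`lineCounts`, `sum_lineCounts`) meets only an obstruction modulo p: if the tuples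
agree modulo p with those of some progression, every choice of typical tuples, one per term, is
realised, with p - 1 parameters left free. Density δ forces at least a constant times δ √n^(p-1)
typical tuples (`card_mul_le_card_image_fiberCount`). This gives order δ^p √n^(p²-1) joint count
vectors, each carried by p^(2n) / √n^(p²-1) words up to a factor polynomial in δ
(`le_card_fiberCount_eq`). The powers of n cancel (`exists_card_progressionWords_lower`).

For removal, delete from each set the residue classes of weight tuples modulo p that are sparse in
it. A surviving progression has all its terms in dense classes and itself witnesses that the
obstruction vanishes, so the original sets contained many progressions. The density statement
follows because deleting few points cannot destroy every degenerate progression. -/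

/-- The number of coordinates of `f` equal to `i`. -/
def fiberCount {ι : Type*} [DecidableEq ι] {n : ℕ} (f : Fin n → ι) (i : ι) : ℕ :=
  (Finset.univ.filter fun k => f k = i).card

/-! ### Words with prescribed letter counts. -/

section Counting

variable {ι : Type*} [DecidableEq ι] {n : ℕ}

theorem sum_fiberCount [Fintype ι] (f : Fin n → ι) : ∑ i, fiberCount f i = n := by
  have := Finset.card_eq_sum_card_fiberwise (s := (Finset.univ : Finset (Fin n)))
    (t := (Finset.univ : Finset ι)) (f := f) (by simp)
  simpa [fiberCount] using this.symm

theorem exists_fiberCount_eq [Fintype ι] (N : ι → ℕ) (hN : ∑ i, N i = n) :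
    ∃ f : Fin n → ι, fiberCount f = N := by
  have hc : Fintype.card (Σ i, Fin (N i)) = n := by simp [hN]
  let e := Fintype.equivFinOfCardEq hc
  refine ⟨fun k => (e.symm k).1, ?_⟩
  funext i
  rw [fiberCount, ← Fintype.card_subtype]
  have : Fintype.card {k : Fin n // (e.symm k).1 = i} = Fintype.card {s : Σ i, Fin (N i) // s.1 = i} :=
    Fintype.card_congr (e.symm.subtypeEquiv fun _ => Iff.rfl)
  rw [this, Fintype.card_congr (Equiv.sigmaSubtype i), Fintype.card_fin]

theorem exists_perm_of_fiberCount_eq (f g : Fin n → ι) (h : fiberCount f = fiberCount g) :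
    ∃ σ : Equiv.Perm (Fin n), f ∘ σ = g := by
  have hc : ∀ i, Nonempty ({k // g k = i} ≃ {k // f k = i}) := fun i => by
    rw [← Fintype.card_eq, Fintype.card_subtype, Fintype.card_subtype]
    exact (congrFun h i).symm
  let e := fun i => (hc i).some
  refine ⟨(Equiv.sigmaFiberEquiv g).symm.trans
    ((Equiv.sigmaCongrRight e).trans (Equiv.sigmaFiberEquiv f)), ?_⟩
  funext k
  exact (e (g k) ⟨k, rfl⟩).2

/-- The number of words with prescribed letter counts is the multinomial coefficient. -/
theorem card_fiberCount_eq_mul_prod_factorial [Fintype ι] (N : ι → ℕ) (hN : ∑ i, N i = n) :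
    (Finset.univ.filter fun g : Fin n → ι => fiberCount g = N).card * ∏ i, (N i).factorial
      = n.factorial := by
  obtain ⟨f, hf⟩ := exists_fiberCount_eq N hN
  have h1 := Finset.card_eq_sum_card_fiberwise (s := (Finset.univ : Finset (Equiv.Perm (Fin n))))
    (t := Finset.univ.filter fun g : Fin n → ι => fiberCount g = N) (f := fun σ : Equiv.Perm (Fin n) => f ∘ σ) (by
      intro σ _
      simp only [Finset.coe_filter, Finset.mem_univ, true_and, Set.mem_ofPred_eq]
      rw [← hf]
      funext i
      simp only [fiberCount, ← Fintype.card_subtype]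
      exact Fintype.card_congr (σ.subtypeEquiv fun _ => Iff.rfl))
  rw [Finset.card_univ, Fintype.card_perm, Fintype.card_fin] at h1
  rw [h1, Finset.sum_const_nat (m := ∏ i, (N i).factorial)]
  intro g hg
  simp only [Finset.mem_filter, Finset.mem_univ, true_and] at hg
  obtain ⟨τ, hτ⟩ := exists_perm_of_fiberCount_eq f g (hf.trans hg.symm)
  -- Orbit-stabilizer: each word is reached from `f` by as many permutations as fix `f`.
  have h2 := DomMulAct.stabilizer_card f
  have h3 : ∀ i, Fintype.card {a // f a = i} = N i := fun i => by
    rw [Fintype.card_subtype, ← hf]; rfl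
  simp only [h3] at h2
  rw [← h2, ← Fintype.card_subtype]
  refine Fintype.card_congr ((Equiv.mulRight τ⁻¹).subtypeEquiv fun σ => ?_)
  rw [← hτ]
  constructor
  · intro h
    funext k
    have := congrFun h (τ⁻¹ k)
    simpa using this
  · intro h
    funext k
    have := congrFun h (τ k)
    simpa using this

end Counting

/-! ### Two-sided bounds for multinomial coefficients. -/

section Stirling

open Real

theorem sqrt_mul_pow_le_factorial (n : ℕ) : √n * (n / exp 1) ^ n ≤ (n.factorial : ℝ) := by
  refine le_trans ?_ (Stirling.le_factorial_stirling n)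
  gcongr
  have := Real.pi_gt_three
  have hn : (0 : ℝ) ≤ n := by positivity
  nlinarith

theorem factorial_le_sqrt_mul_pow {n : ℕ} (hn : 1 ≤ n) :
    (n.factorial : ℝ) ≤ 3 * √n * (n / exp 1) ^ n := by
  obtain ⟨k, rfl⟩ : ∃ k, n = k + 1 := ⟨n - 1, by omega⟩
  -- The Stirling ratio decreases from its first value e / √2, and e < 3 gives the constant.
  have h := Stirling.stirlingSeq'_antitone (Nat.zero_le k)
  simp only [Function.comp, Nat.succ_eq_add_one, zero_add, Stirling.stirlingSeq_one] at h
  rw [Stirling.stirlingSeq, div_le_iff₀ (by positivity)] at h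
  refine h.trans ?_
  have h2 : √(2 * ((k + 1 : ℕ) : ℝ)) = √2 * √((k + 1 : ℕ) : ℝ) := by
    rw [Real.sqrt_mul (by norm_num)]
  rw [h2]
  have h3 : exp 1 / √2 * (√2 * √((k + 1 : ℕ) : ℝ) * (((k + 1 : ℕ) : ℝ) / exp 1) ^ (k + 1))
      = exp 1 * √((k + 1 : ℕ) : ℝ) * (((k + 1 : ℕ) : ℝ) / exp 1) ^ (k + 1) := by
    field_simp
  rw [h3]
  gcongr
  exact Real.exp_one_lt_three.le

variable {ι : Type*} [Fintype ι] {n : ℕ}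

theorem prod_pow_self_eq_exp (N : ι → ℕ) (hN : ∑ i, N i = n) (hpos : ∀ i, 1 ≤ N i)
    {c : ℝ} (hc : 0 < c) :
    ∏ i, ((N i : ℝ) / exp 1) ^ N i = (c / exp 1) ^ n * exp (∑ i, N i * log (N i / c)) := by
  rw [Real.exp_sum, ← hN, ← Finset.prod_pow_eq_pow_sum, ← Finset.prod_mul_distrib]
  refine Finset.prod_congr rfl fun i _ => ?_
  have : (0 : ℝ) < N i := by exact_mod_cast hpos i
  rw [← Real.rpow_natCast (c / exp 1), ← Real.rpow_natCast, mul_comm (N i : ℝ) (log _),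
    ← Real.rpow_def_of_pos (by positivity), ← Real.mul_rpow (by positivity) (by positivity)]
  congr 1
  field_simp

variable [DecidableEq ι] [Nonempty ι]

/-- Stirling together with nonnegativity of relative entropy: no letter distribution beats the
uniform one. The lower bound on each `N i` controls the square-root factors. -/
theorem card_fiberCount_eq_le (N : ι → ℕ) (hN : ∑ i, N i = n)
    (hpos : ∀ i, 1 ≤ N i) (hlow : ∀ i, (n : ℝ) / (2 * Fintype.card ι) ≤ N i) :
    ((Finset.univ.filter fun g : Fin n → ι => fiberCount g = N).card : ℝ)
      * √n ^ (Fintype.card ι - 1) ≤ 3 * √(2 * Fintype.card ι) ^ Fintype.card ι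
        * (Fintype.card ι : ℝ) ^ n := by
  have hm : 0 < Fintype.card ι := Fintype.card_pos
  set m := Fintype.card ι with hmdef
  set c := (Finset.univ.filter fun g : Fin n → ι => fiberCount g = N).card
  have hn : 1 ≤ n := by
    rw [← hN]
    exact (hpos (Classical.arbitrary ι)).trans
      (Finset.single_le_sum (f := N) (fun _ _ => Nat.zero_le _) (Finset.mem_univ _))
  have hn0 : (0 : ℝ) < n := by exact_mod_cast hn
  have hm0 : (0 : ℝ) < m := by exact_mod_cast hm
  have h1 : (c : ℝ) * ∏ i, ((N i).factorial : ℝ) = n.factorial := by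
    exact_mod_cast card_fiberCount_eq_mul_prod_factorial N hN
  -- Gibbs' inequality, from log y ≥ 1 - 1/y; the linear terms sum to zero.
  have hlog : 0 ≤ ∑ i, (N i : ℝ) * log (N i / (n / m)) := by
    have : ∑ i, ((N i : ℝ) - n / m) ≤ ∑ i, (N i : ℝ) * log (N i / (n / m)) := by
      refine Finset.sum_le_sum fun i _ => ?_
      have hi : (0 : ℝ) < N i := by exact_mod_cast hpos i
      have := Real.one_sub_inv_le_log_of_pos (x := N i / (n / m)) (by positivity)
      calc (N i : ℝ) - n / m = N i * (1 - ((N i : ℝ) / (n / m))⁻¹) := by field_simp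
        _ ≤ _ := by gcongr
    refine le_trans (le_of_eq ?_) this
    rw [Finset.sum_sub_distrib, Finset.sum_const, Finset.card_univ, ← hmdef, ← Nat.cast_sum, hN,
      nsmul_eq_mul]
    field_simp
    simp
  have h2 : (√n / √(2 * m)) ^ m * ((n / m) / exp 1) ^ n ≤ ∏ i, ((N i).factorial : ℝ) := by
    calc (√n / √(2 * m)) ^ m * ((n / m) / exp 1) ^ n
        ≤ (∏ i, √(N i)) * ∏ i, ((N i : ℝ) / exp 1) ^ N i := by
          gcongr
          · rw [hmdef, ← Finset.card_univ, ← Finset.prod_const]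
            refine Finset.prod_le_prod (fun _ _ => by positivity) fun i _ => ?_
            rw [← Real.sqrt_div hn0.le]
            exact Real.sqrt_le_sqrt (hlow i)
          · rw [prod_pow_self_eq_exp N hN hpos (c := n / m) (by positivity)]
            exact le_mul_of_one_le_right (by positivity) (Real.one_le_exp hlog)
      _ = ∏ i, √(N i) * ((N i : ℝ) / exp 1) ^ N i := Finset.prod_mul_distrib.symm
      _ ≤ _ := Finset.prod_le_prod (fun _ _ => by positivity)
          fun i _ => sqrt_mul_pow_le_factorial (N i)
  have h3 : (c : ℝ) * ((√n / √(2 * m)) ^ m * ((n / m) / exp 1) ^ n)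
      ≤ 3 * √n * (n / exp 1) ^ n :=
    (mul_le_mul_of_nonneg_left h2 (by positivity)).trans
      (h1.le.trans (factorial_le_sqrt_mul_pow hn))
  obtain ⟨k, hk⟩ : ∃ k, m = k + 1 := ⟨m - 1, by omega⟩
  have h4 : (c : ℝ) * ((√n / √(2 * m)) ^ m * ((n / m) / exp 1) ^ n)
      = (c * √n ^ (m - 1)) * (√n * (n / exp 1) ^ n / (√(2 * m) ^ m * (m : ℝ) ^ n)) := by
    have : √(n : ℝ) ^ m = √n ^ (m - 1) * √n := by
      rw [← pow_succ]; congr 1; omega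
    rw [div_pow, this, div_div, mul_comm (m : ℝ), ← div_div, div_pow _ (m : ℝ)]
    have : √(2 * (m : ℝ)) ≠ 0 := by positivity
    field_simp
  rw [h4, ← le_div_iff₀ (by positivity)] at h3
  refine h3.trans (le_of_eq ?_)
  have : √(2 * (m : ℝ)) ≠ 0 := by positivity
  field_simp

/-- Near the uniform distribution the relative entropy is at most a chi-square sum, so deviations of
order √n cost only a factor independent of n. -/
theorem le_card_fiberCount_eq (N : ι → ℕ) (hN : ∑ i, N i = n)
    (hpos : ∀ i, 1 ≤ N i) {D : ℝ}
    (hD : ∀ i, |(N i : ℝ) - n / Fintype.card ι| ≤ D * √n) :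
    (Fintype.card ι : ℝ) ^ n ≤
    ((Finset.univ.filter fun g : Fin n → ι => fiberCount g = N).card : ℝ)
      * (3 ^ Fintype.card ι * √n ^ (Fintype.card ι - 1)
        * exp ((Fintype.card ι : ℝ) ^ 2 * D ^ 2)) := by
  have hm : 0 < Fintype.card ι := Fintype.card_pos
  set m := Fintype.card ι with hmdef
  set c := (Finset.univ.filter fun g : Fin n → ι => fiberCount g = N).card
  have hn : 1 ≤ n := by
    rw [← hN]
    exact (hpos (Classical.arbitrary ι)).trans
      (Finset.single_le_sum (f := N) (fun _ _ => Nat.zero_le _) (Finset.mem_univ _))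
  have hn0 : (0 : ℝ) < n := by exact_mod_cast hn
  have hm0 : (0 : ℝ) < m := by exact_mod_cast hm
  have h1 : (c : ℝ) * ∏ i, ((N i).factorial : ℝ) = n.factorial := by
    exact_mod_cast card_fiberCount_eq_mul_prod_factorial N hN
  have hlog : ∑ i, (N i : ℝ) * log (N i / (n / m)) ≤ (m : ℝ) ^ 2 * D ^ 2 := by
    have h0 : ∑ i, ((N i : ℝ) - n / m) = 0 := by
      rw [Finset.sum_sub_distrib, Finset.sum_const, Finset.card_univ, ← hmdef, ← Nat.cast_sum, hN,
        nsmul_eq_mul]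
      field_simp
      simp
    have : ∑ i, (N i : ℝ) * log (N i / (n / m)) ≤ ∑ i, (((N i : ℝ) - n / m) + m * D ^ 2) := by
      refine Finset.sum_le_sum fun i _ => ?_
      have hi : (0 : ℝ) < N i := by exact_mod_cast hpos i
      have := Real.log_le_sub_one_of_pos (x := N i / (n / m)) (by positivity)
      have hsq : ((N i : ℝ) - n / m) ^ 2 ≤ D ^ 2 * n := by
        have := pow_le_pow_left₀ (abs_nonneg _) (hD i) 2
        rwa [sq_abs, mul_pow, Real.sq_sqrt hn0.le] at this
      calc (N i : ℝ) * log (N i / (n / m)) ≤ N i * (N i / (n / m) - 1) := by gcongr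
        _ = ((N i : ℝ) - n / m) + m / n * ((N i : ℝ) - n / m) ^ 2 := by field_simp; ring
        _ ≤ ((N i : ℝ) - n / m) + m / n * (D ^ 2 * n) := by gcongr
        _ = _ := by field_simp
    refine this.trans (le_of_eq ?_)
    rw [Finset.sum_add_distrib, h0, Finset.sum_const, Finset.card_univ, ← hmdef, nsmul_eq_mul]
    ring
  have h2 : ∏ i, ((N i).factorial : ℝ) ≤ (3 * √n) ^ m * (((n / m) / exp 1) ^ n
      * exp ((m : ℝ) ^ 2 * D ^ 2)) := by
    calc ∏ i, ((N i).factorial : ℝ) ≤ ∏ i, (3 * √n) * ((N i : ℝ) / exp 1) ^ N i := by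
          refine Finset.prod_le_prod (fun _ _ => by positivity) fun i _ => ?_
          refine (factorial_le_sqrt_mul_pow (hpos i)).trans ?_
          gcongr
          rw [← hN]
          exact Finset.single_le_sum (f := N) (fun _ _ => Nat.zero_le _) (Finset.mem_univ _)
      _ = (3 * √n) ^ m * ∏ i, ((N i : ℝ) / exp 1) ^ N i := by
          rw [Finset.prod_mul_distrib, Finset.prod_const, Finset.card_univ]
      _ ≤ _ := by
          rw [prod_pow_self_eq_exp N hN hpos (c := n / m) (by positivity)]
          gcongr
  have h3 : √n * (n / exp 1) ^ n ≤ c * ((3 * √n) ^ m * (((n / m) / exp 1) ^ n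
      * exp ((m : ℝ) ^ 2 * D ^ 2))) :=
    (sqrt_mul_pow_le_factorial n).trans (h1.symm.le.trans
      (mul_le_mul_of_nonneg_left h2 (by positivity)))
  have hs : 0 < √(n : ℝ) := by positivity
  have h4 : c * ((3 * √n) ^ m * (((n / m) / exp 1) ^ n * exp ((m : ℝ) ^ 2 * D ^ 2)))
      = (c * (3 ^ m * √n ^ (m - 1) * exp ((m : ℝ) ^ 2 * D ^ 2))) / (m : ℝ) ^ n
        * (√n * (n / exp 1) ^ n) := by
    have : √(n : ℝ) ^ m = √n ^ (m - 1) * √n := by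
      rw [← pow_succ]; congr 1; omega
    rw [mul_pow, this, div_div, mul_comm (m : ℝ), ← div_div, div_pow _ (m : ℝ)]
    ring
  rw [h4] at h3
  have hpow : 0 < √n * (n / exp 1) ^ n := by positivity
  rw [le_mul_iff_one_le_left hpow, le_div_iff₀ (by positivity), one_mul] at h3
  exact h3

end Stirling

/-! ### Concentration of the weights. -/

section Tail

open Real

variable {ι : Type*} [Fintype ι] {n : ℕ}

/-- Chernoff's method: for |y| ≤ 1, exp y ≤ 1 + y + y², and the linear term averages to zero. -/
theorem card_exp_mul_le {Y : ι → ℝ} (hY : ∑ b, Y b = 0) (hY1 : ∀ b, |Y b| ≤ 1) {t l : ℝ}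
    (hl : |l| ≤ 1) :
    ((Finset.univ.filter fun x : Fin n → ι => t ≤ l * ∑ k, Y (x k)).card : ℝ)
      ≤ (Fintype.card ι : ℝ) ^ n * exp (n * l ^ 2 - t) := by
  have h1 : ∑ x : Fin n → ι, exp (l * ∑ k, Y (x k)) = (∑ b, exp (l * Y b)) ^ n := by
    simp_rw [Finset.mul_sum, Real.exp_sum]
    rw [← Fintype.card_fin n, ← Finset.card_univ, ← Finset.prod_const, Finset.card_univ,
      Fintype.card_fin, Finset.prod_univ_sum]
    simp
  have h2 : ∑ b, exp (l * Y b) ≤ Fintype.card ι * exp (l ^ 2) := by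
    calc ∑ b, exp (l * Y b) ≤ ∑ b, (1 + l ^ 2 + l * Y b) := by
          refine Finset.sum_le_sum fun b _ => ?_
          have hb : |l * Y b| ≤ 1 := by
            rw [abs_mul]; exact mul_le_one₀ hl (abs_nonneg _) (hY1 b)
          have h3 := (abs_le.1 (Real.abs_exp_sub_one_sub_id_le hb)).2
          have h4 : (Y b) ^ 2 ≤ 1 := by
            rw [← sq_abs]; exact pow_le_one₀ (abs_nonneg _) (hY1 b)
          nlinarith [sq_nonneg l]
      _ = Fintype.card ι * (l ^ 2 + 1) := by
          rw [Finset.sum_add_distrib, ← Finset.mul_sum, hY]; simp; ring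
      _ ≤ _ := by gcongr; exact Real.add_one_le_exp _
  have h3 : ((Finset.univ.filter fun x : Fin n → ι => t ≤ l * ∑ k, Y (x k)).card : ℝ) * exp t
      ≤ ∑ x : Fin n → ι, exp (l * ∑ k, Y (x k)) := by
    rw [← nsmul_eq_mul]
    refine (Finset.card_nsmul_le_sum _ (fun x => exp (l * ∑ k, Y (x k))) _ ?_).trans
      (Finset.sum_le_sum_of_subset_of_nonneg (Finset.filter_subset _ _)
        fun _ _ _ => (exp_pos _).le)
    intro x hx
    exact exp_le_exp.2 (Finset.mem_filter.1 hx).2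
  rw [Real.exp_sub, ← mul_div_assoc, le_div_iff₀ (exp_pos _)]
  refine h3.trans ?_
  rw [h1, mul_comm (n : ℝ), Real.exp_mul, Real.rpow_natCast, ← mul_pow]
  exact pow_le_pow_left₀ (Finset.sum_nonneg fun _ _ => (exp_pos _).le) h2 n

/-- A Hoeffding-type bound for the number of words with an atypical number of letters `a`. -/
theorem card_fiberCount_far_le [DecidableEq ι] (a : ι) {K : ℝ} (hK : 0 ≤ K) (hn : 0 < n) (hKn : K ≤ √n) :
    ((Finset.univ.filter fun x : Fin n → ι =>
      K * √n < |(fiberCount x a : ℝ) - n / Fintype.card ι|).card : ℝ)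
      ≤ 2 * (Fintype.card ι : ℝ) ^ n * exp (- (K ^ 2 / 4)) := by
  have hm : 0 < Fintype.card ι := Fintype.card_pos_iff.2 ⟨a⟩
  have hm1 : (1 : ℝ) ≤ Fintype.card ι := by exact_mod_cast hm
  have hn0 : (0 : ℝ) < n := by exact_mod_cast hn
  have hs : 0 < √(n : ℝ) := by positivity
  let Y : ι → ℝ := fun b => (if b = a then 1 else 0) - 1 / Fintype.card ι
  have hY : ∑ b, Y b = 0 := by
    simp only [Y, Finset.sum_sub_distrib, Finset.sum_ite_eq', Finset.mem_univ, if_true]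
    simp only [Finset.sum_const, Finset.card_univ, nsmul_eq_mul]
    field_simp
    simp
  have hY1 : ∀ b, |Y b| ≤ 1 := by
    intro b
    have h1 : 1 / (Fintype.card ι : ℝ) ≤ 1 := by
      rw [div_le_one (by linarith)]; exact hm1
    have h2 : 0 ≤ 1 / (Fintype.card ι : ℝ) := by positivity
    simp only [Y]
    rw [abs_le]
    split_ifs <;> constructor <;> linarith
  have hsum : ∀ x : Fin n → ι, ∑ k, Y (x k) = (fiberCount x a : ℝ) - n / Fintype.card ι := by
    intro x
    simp only [Y, Finset.sum_sub_distrib, fiberCount]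
    simp
    ring
  -- This minimises n l² - l K √n; the minimum is -K²/4.
  set l : ℝ := K / (2 * √n) with hl
  have hl0 : 0 ≤ l := by positivity
  have hl1 : |l| ≤ 1 := by
    rw [abs_of_nonneg hl0, hl, div_le_one (by positivity)]; linarith
  have e1 : (n : ℝ) * l ^ 2 - K ^ 2 / 2 = - (K ^ 2 / 4) := by
    rw [hl, div_pow, mul_pow, Real.sq_sqrt hn0.le]; field_simp; ring
  have hlK : l * (K * √n) = K ^ 2 / 2 := by rw [hl]; field_simp
  have b1 := card_exp_mul_le (n := n) hY hY1 (t := K ^ 2 / 2) hl1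
  have b2 := card_exp_mul_le (n := n) hY hY1 (t := K ^ 2 / 2) (l := -l) (by rwa [abs_neg])
  rw [neg_sq] at b2
  rw [e1] at b1 b2
  have hsub : (Finset.univ.filter fun x : Fin n → ι =>
      K * √n < |(fiberCount x a : ℝ) - n / Fintype.card ι|) ⊆
      (Finset.univ.filter fun x : Fin n → ι => K ^ 2 / 2 ≤ l * ∑ k, Y (x k)) ∪
      (Finset.univ.filter fun x : Fin n → ι => K ^ 2 / 2 ≤ -l * ∑ k, Y (x k)) := by
    intro x hx
    simp only [Finset.mem_filter, Finset.mem_univ, true_and, Finset.mem_union, hsum] at hx ⊢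
    rcases lt_abs.1 hx with h | h
    · left; rw [← hlK]; exact mul_le_mul_of_nonneg_left h.le hl0
    · right; rw [← hlK, neg_mul, ← mul_neg]; exact mul_le_mul_of_nonneg_left h.le hl0
  have h5 := (Nat.cast_le (α := ℝ)).2 ((Finset.card_le_card hsub).trans (Finset.card_union_le _ _))
  rw [Nat.cast_add] at h5
  linarith

end Tail

/-! ### Inverting the line transform on the affine plane over 𝔽_p. -/

section Lines

variable {p : ℕ} [Fact p.Prime]

/-- The sum of the array `w` over the points of the line `a = x + j d`. -/
def lineSum (w : ZMod p → ZMod p → ℤ) (x d : ZMod p) : ℤ := ∑ j, w j (x + j * d)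

/-- Line multiplicities whose sums over the lines through `(j, a)` recover `w j a`,
parametrised by the values `h d` on the lines through the origin. -/
def lineCounts (w : ZMod p → ZMod p → ℤ) (h : ZMod p → ℤ) (x d : ZMod p) : ℤ :=
  (lineSum w x d - lineSum w 0 d) / p + h d

theorem sum_comp_add_mul (g : ZMod p → ℤ) (a : ZMod p) {c : ZMod p} (hc : c ≠ 0) :
    ∑ d, g (a + c * d) = ∑ b, g b :=
  Fintype.sum_equiv ((Equiv.mulLeft₀ c hc).trans (Equiv.addLeft a)) _ _ fun d => by simp

/-- The non-vertical lines through (j, a) share that point and cover every point of each other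
column exactly once. -/
theorem sum_lineSum (w : ZMod p → ZMod p → ℤ) {n : ℤ} (hw : ∀ j, ∑ a, w j a = n)
    (j a : ZMod p) :
    ∑ d, lineSum w (a - j * d) d = p * w j a + (p - 1) * n := by
  unfold lineSum
  rw [Finset.sum_comm, ← Finset.add_sum_erase _ _ (Finset.mem_univ j)]
  congr 1
  · simp [ZMod.card]
  · rw [Finset.sum_congr rfl (g := fun _ => n)]
    · have hp := (Fact.out : p.Prime).one_le
      simp [Finset.card_erase_of_mem, ZMod.card, Nat.cast_sub hp]
    · intro i hi
      rw [← hw i, ← sum_comp_add_mul (w i) a (sub_ne_zero.2 (Finset.ne_of_mem_erase hi))]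
      refine Finset.sum_congr rfl fun d _ => ?_
      congr 1
      ring

/-- Subtracting the lines through the origin cancels the term (p - 1) n of `sum_lineSum`; the
condition on `h` restores the missing `w 0 0`. -/
theorem sum_lineCounts (w : ZMod p → ZMod p → ℤ) {n : ℤ} (hw : ∀ j, ∑ a, w j a = n)
    (h : ZMod p → ℤ) (hdvd : ∀ x d, (p : ℤ) ∣ lineSum w x d - lineSum w 0 d)
    (hh : ∑ d, h d = w 0 0) (j a : ZMod p) :
    ∑ d, lineCounts w h (a - j * d) d = w j a := by
  have hp0 : (p : ℤ) ≠ 0 := by exact_mod_cast (Fact.out : p.Prime).ne_zero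
  have h0 := sum_lineSum w hw 0 0
  simp only [zero_mul, sub_zero] at h0
  have h1 := sum_lineSum w hw j a
  apply mul_left_cancel₀ hp0
  unfold lineCounts
  rw [Finset.mul_sum]
  simp only [mul_add, Int.mul_ediv_cancel' (hdvd _ _)]
  rw [Finset.sum_add_distrib, Finset.sum_sub_distrib, h0, h1, ← Finset.mul_sum, hh]
  ring

/-- A line meets itself in p points, its other parallels nowhere, and each line of another slope
once. Modulo p the result therefore depends only on the slope. -/
theorem lineSum_of_lines (N : ZMod p → ZMod p → ℤ) (x d : ZMod p) :
    lineSum (fun j a => ∑ e, N (a - j * e) e) x d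
      = p * N x d + ∑ e ∈ Finset.univ.erase d, ∑ y, N y e := by
  unfold lineSum
  rw [Finset.sum_comm, ← Finset.add_sum_erase _ _ (Finset.mem_univ d)]
  congr 1
  · simp [ZMod.card]
  · refine Finset.sum_congr rfl fun e he => ?_
    rw [← sum_comp_add_mul (fun y => N y e) x (sub_ne_zero.2 (Finset.ne_of_mem_erase he).symm)]
    refine Finset.sum_congr rfl fun j _ => ?_
    congr 1
    ring

theorem dvd_lineSum_sub (w : ZMod p → ZMod p → ℤ) (N : ZMod p → ZMod p → ℤ)
    (hwN : ∀ j a, (p : ℤ) ∣ w j a - ∑ e, N (a - j * e) e) (x d : ZMod p) :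
    (p : ℤ) ∣ lineSum w x d - lineSum w 0 d := by
  have key : ∀ x, (p : ℤ) ∣ lineSum w x d - ∑ e ∈ Finset.univ.erase d, ∑ y, N y e := by
    intro x
    have h1 : (p : ℤ) ∣ lineSum w x d - lineSum (fun j a => ∑ e, N (a - j * e) e) x d := by
      unfold lineSum
      rw [← Finset.sum_sub_distrib]
      exact Finset.dvd_sum fun j _ => hwN j _
    rw [lineSum_of_lines] at h1
    have h2 := dvd_add h1 (Dvd.intro (N x d) rfl)
    rwa [sub_add_eq_sub_sub_swap, sub_add_cancel] at h2
  have := dvd_sub (key x) (key 0)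
  rwa [sub_sub_sub_cancel_right] at this

theorem fiberCount_progression {n : ℕ} (f : Fin n → ZMod p × ZMod p) (t a : ZMod p) :
    fiberCount (fun k => (f k).1 + t * (f k).2) a = ∑ d, fiberCount f (a - t * d, d) := by
  unfold fiberCount
  rw [Finset.card_eq_sum_card_fiberwise (f := fun k => (f k).2) (t := Finset.univ) (by simp)]
  refine Finset.sum_congr rfl fun d _ => ?_
  congr 1
  ext k
  simp only [Finset.mem_filter, Finset.mem_univ, true_and, Prod.ext_iff]
  constructor
  · rintro ⟨h1, rfl⟩
    exact ⟨by rw [← h1]; ring, rfl⟩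
  · rintro ⟨h1, h2⟩
    exact ⟨by rw [h1, h2]; ring, h2⟩

/-- The values on the lines through the origin: `H + e d` for `d ≠ 0`, and whatever is needed
to reach the total `c` for `d = 0`. -/
def originCounts (c H : ℤ) (e : ZMod p → ℕ) (d : ZMod p) : ℤ :=
  if d = 0 then c - ∑ d' ∈ Finset.univ.erase 0, (H + e d') else H + e d

theorem sum_originCounts (c H : ℤ) (e : ZMod p → ℕ) : ∑ d, originCounts c H e d = c := by
  rw [← Finset.add_sum_erase _ _ (Finset.mem_univ (0 : ZMod p))]
  have : ∑ d ∈ Finset.univ.erase 0, originCounts c H e d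
      = ∑ d' ∈ Finset.univ.erase 0, (H + e d') :=
    Finset.sum_congr rfl fun d hd => by simp [originCounts, Finset.ne_of_mem_erase hd]
  rw [this]
  simp [originCounts]

/-- Line sums are within p K √n of n, so the quotient contributes 2K √n. The prescribed values at
the origin contribute at most (K + 2p) √n, the worst case being the slope 0 that absorbs the total.
-/
theorem abs_lineCounts_sub_le {w : ZMod p → ZMod p → ℤ} {n H : ℕ} {e : ZMod p → ℕ} {K : ℝ}
    (hK : 0 ≤ K) (hn : 1 ≤ n) (hH : H = n / p ^ 2)
    (hdvd : ∀ x d, (p : ℤ) ∣ lineSum w x d - lineSum w 0 d)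
    (hw : ∀ j a, |(w j a : ℝ) - n / p| ≤ K * √n) (he : ∀ d, (e d : ℝ) ≤ √n) (x d : ZMod p) :
    |(lineCounts w (originCounts (w 0 0) H e) x d : ℝ) - n / (p : ℝ) ^ 2|
      ≤ (3 * K + 2 * p) * √n := by
  have hp1 : (1 : ℝ) ≤ p := by exact_mod_cast (Fact.out : p.Prime).one_le
  have hp0 : (0 : ℝ) < p := by linarith
  have hs1 : (1 : ℝ) ≤ √n := by
    rw [Real.one_le_sqrt]; exact_mod_cast hn
  have hls : ∀ x, |(lineSum w x d : ℝ) - n| ≤ p * (K * √n) := by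
    intro x
    have : (lineSum w x d : ℝ) - n = ∑ j, ((w j (x + j * d) : ℝ) - n / p) := by
      rw [Finset.sum_sub_distrib]
      simp only [lineSum, Int.cast_sum, Finset.sum_const, Finset.card_univ, ZMod.card,
        nsmul_eq_mul]
      rw [mul_div_cancel₀ _ hp0.ne']
    rw [this]
    refine (Finset.abs_sum_le_sum_abs _ _).trans ((Finset.sum_le_card_nsmul _ _ (K * √n)
      fun j _ => hw j _).trans ?_)
    simp [ZMod.card]
  have hquot : |((lineSum w x d - lineSum w 0 d : ℤ) : ℝ) / p| ≤ 2 * K * √n := by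
    rw [abs_div, abs_of_pos hp0, div_le_iff₀ hp0]
    have h1 := abs_le.1 (hls x)
    have h2 := abs_le.1 (hls 0)
    push_cast
    rw [abs_le]
    constructor <;> nlinarith
  have hHr : |(H : ℝ) - n / (p : ℝ) ^ 2| ≤ 1 := by
    have hp2 : (0 : ℝ) < (p : ℝ) ^ 2 := by positivity
    have h1 : (H : ℝ) ≤ n / (p : ℝ) ^ 2 := by
      rw [hH]; exact_mod_cast Nat.cast_div_le (α := ℝ) (m := n) (n := p ^ 2)
    have h2 : (n : ℝ) / (p : ℝ) ^ 2 ≤ H + 1 := by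
      rw [div_le_iff₀ hp2, hH]
      have := Nat.lt_div_mul_add (a := n) (b := p ^ 2) (by
        have := (Fact.out : p.Prime).pos; positivity)
      have h3 : (n : ℝ) < (n / p ^ 2 : ℕ) * (p : ℝ) ^ 2 + (p : ℝ) ^ 2 := by exact_mod_cast this
      linarith
    rw [abs_le]; constructor <;> linarith
  have hHe : ∀ d, |((H : ℝ) + e d) - n / (p : ℝ) ^ 2| ≤ 2 * √n := by
    intro d
    have h1 := abs_le.1 hHr
    have h2 := he d
    have h3 : (0 : ℝ) ≤ e d := by positivity
    rw [abs_le]; constructor <;> linarith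
  have horig : |(originCounts (w 0 0) H e d : ℝ) - n / (p : ℝ) ^ 2| ≤ (K + 2 * p) * √n := by
    unfold originCounts
    split_ifs with hd
    · have : (((w 0 0 - ∑ d' ∈ Finset.univ.erase 0, ((H : ℤ) + e d') : ℤ)) : ℝ) - n / (p : ℝ) ^ 2
          = ((w 0 0 : ℝ) - n / p)
            - ∑ d' ∈ Finset.univ.erase (0 : ZMod p), (((H : ℝ) + e d') - n / (p : ℝ) ^ 2) := by
        rw [Finset.sum_sub_distrib (G := ℝ)]
        push_cast
        have : ∑ d' ∈ Finset.univ.erase (0 : ZMod p), (n : ℝ) / (p : ℝ) ^ 2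
            = (p - 1) * (n / (p : ℝ) ^ 2) := by
          have hp := (Fact.out : p.Prime).one_le
          simp [Finset.card_erase_of_mem, ZMod.card, Nat.cast_sub hp]
        rw [this]
        field_simp
        ring
      rw [this]
      have h1 : |∑ d' ∈ Finset.univ.erase (0 : ZMod p), (((H : ℝ) + e d') - n / (p : ℝ) ^ 2)|
          ≤ p * (2 * √n) := by
        refine (Finset.abs_sum_le_sum_abs _ _).trans ((Finset.sum_le_sum_of_subset_of_nonneg
          (Finset.erase_subset _ _) fun _ _ _ => abs_nonneg _).trans
          ((Finset.sum_le_card_nsmul _ _ (2 * √n) fun j _ => hHe j).trans ?_))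
        simp [ZMod.card]
      refine (abs_sub _ _).trans ?_
      have := hw 0 0
      linarith
    · push_cast
      refine (hHe d).trans ?_
      have : 0 ≤ K * √n := by positivity
      nlinarith
  have hcast : (lineCounts w (originCounts (w 0 0) H e) x d : ℝ)
      = ((lineSum w x d - lineSum w 0 d : ℤ) : ℝ) / p + originCounts (w 0 0) H e d := by
    rw [lineCounts, Int.cast_add, Int.cast_div (hdvd x d) (by exact_mod_cast hp0.ne')]
    simp
  rw [hcast, add_sub_assoc]
  refine (abs_add_le _ _).trans ?_
  linarith

end Lines

/-! ### Counting progressions through joint letter counts. -/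

section Progressions

open Real

variable {p : ℕ} [Fact p.Prime] {n : ℕ}

/-- The pairs `(x, d)`, encoded as words over `𝔽_p × 𝔽_p`, with `x + t d ∈ A t` for all `t`. -/
def progressionWords (A : ZMod p → Finset (Fin n → ZMod p)) : Finset (Fin n → ZMod p × ZMod p) :=
  Finset.univ.filter fun f => ∀ t, (fun k => (f k).1 + t * (f k).2) ∈ A t

/-- Any choice `u t` of typical letter counts from the `A t` is realised by joint letter counts
close to uniform, with prescribed values `e` on the lines through the origin. -/
theorem lineCounts_toNat_spec (A : ZMod p → Finset (Fin n → ZMod p))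
    (f₀ : Fin n → ZMod p × ZMod p)
    (hres : ∀ t, ∀ x ∈ A t, ∀ a, (p : ℤ) ∣
      (fiberCount x a : ℤ) - fiberCount (fun k => (f₀ k).1 + t * (f₀ k).2) a)
    {K : ℝ} (hK : 0 ≤ K)
    (htyp : ∀ t, ∀ x ∈ A t, ∀ a, |(fiberCount x a : ℝ) - n / p| ≤ K * √n)
    (hn1 : 1 ≤ n) (hn : (3 * K + 2 * p) * √n + 1 ≤ n / (p : ℝ) ^ 2)
    (u : ZMod p → ZMod p → ℕ) (hu : ∀ t, u t ∈ (A t).image fiberCount)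
    (e : ZMod p → ℕ) (he : ∀ d, (e d : ℝ) ≤ √n) :
    ∃ N : ZMod p × ZMod p → ℕ,
      (∀ x d, (N (x, d) : ℤ) = lineCounts (fun t a => (u t a : ℤ))
        (originCounts (u 0 0) (n / p ^ 2 : ℕ) e) x d) ∧
      (∀ i, 1 ≤ N i) ∧ (∑ i, N i = n) ∧
      (∀ t a, ∑ d, N (a - t * d, d) = u t a) ∧
      (∀ i, |(N i : ℝ) - n / (p : ℝ) ^ 2| ≤ (3 * K + 2 * p) * √n) := by
  choose y hyA hyu using fun t => Finset.mem_image.1 (hu t)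
  set w : ZMod p → ZMod p → ℤ := fun t a => (u t a : ℤ) with hw
  have hwsum : ∀ t, ∑ a, w t a = n := fun t => by
    simp only [hw, ← hyu]
    exact_mod_cast sum_fiberCount (y t)
  have hdvd : ∀ x d, (p : ℤ) ∣ lineSum w x d - lineSum w 0 d :=
    dvd_lineSum_sub w (fun x d => fiberCount f₀ (x, d)) fun t a => by
      have := hres t (y t) (hyA t) a
      rw [fiberCount_progression] at this
      simpa [hw, ← hyu] using this
  have hwtyp : ∀ t a, |(w t a : ℝ) - n / p| ≤ K * √n := fun t a => by
    simpa [hw, ← hyu] using htyp t (y t) (hyA t) a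
  have hb := abs_lineCounts_sub_le (e := e) hK hn1 rfl hdvd hwtyp he
  have hsum := sum_lineCounts w hwsum _ hdvd (sum_originCounts (w 0 0) (n / p ^ 2 : ℕ) e)
  change ∃ N : ZMod p × ZMod p → ℕ, (∀ x d, (N (x, d) : ℤ)
    = lineCounts w (originCounts (w 0 0) (n / p ^ 2 : ℕ) e) x d) ∧ _
  generalize lineCounts w (originCounts (w 0 0) (n / p ^ 2 : ℕ) e) = M at hb hsum ⊢
  have hpos : ∀ x d, 1 ≤ M x d := by
    intro x d
    have := (abs_le.1 (hb x d)).1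
    exact_mod_cast (by linarith : (1 : ℝ) ≤ M x d)
  have hN : ∀ x d, ((M x d).toNat : ℤ) = M x d :=
    fun x d => Int.toNat_of_nonneg (by linarith [hpos x d])
  have hmarg : ∀ t a, ∑ d, (M (a - t * d) d).toNat = u t a := by
    intro t a
    have h2 : ((∑ d, (M (a - t * d) d).toNat : ℕ) : ℤ) = (u t a : ℤ) := by
      rw [Nat.cast_sum, Finset.sum_congr rfl fun d _ => hN _ _]
      exact hsum t a
    exact_mod_cast h2
  refine ⟨fun i => (M i.1 i.2).toNat, fun x d => hN x d, fun i => ?_, ?_, hmarg, fun i => ?_⟩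
  · have := hpos i.1 i.2
    change 1 ≤ (M i.1 i.2).toNat
    omega
  · have h1 : ∑ a, u 0 a = n := by
      have := hwsum 0
      simp only [hw] at this
      exact_mod_cast this
    rw [Fintype.sum_prod_type, ← h1]
    refine Finset.sum_congr rfl fun a _ => ?_
    rw [← hmarg 0 a]
    simp
  · have := hb i.1 i.2
    rw [← hN] at this
    exact_mod_cast this

theorem card_pi_if_zero (k : ℕ) :
    (Fintype.piFinset fun d : ZMod p => if d = 0 then {0} else Finset.range (k + 1)).card
      = (k + 1) ^ (p - 1) := by
  rw [Fintype.card_piFinset, ← Finset.mul_prod_erase _ _ (Finset.mem_univ (0 : ZMod p)),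
    Finset.prod_congr rfl (g := fun _ => k + 1)]
  · simp [Finset.card_erase_of_mem, ZMod.card]
  · intro d hd
    simp [Finset.ne_of_mem_erase hd]

/-- Distinct pairs of a choice of tuples and a choice of free parameters give distinct joint counts,
hence disjoint classes of words, each bounded below by `le_card_fiberCount_eq`. -/
theorem card_progressionWords_ge (A : ZMod p → Finset (Fin n → ZMod p))
    (hsym : ∀ t, SymmetricSet (A t)) (f₀ : Fin n → ZMod p × ZMod p)
    (hres : ∀ t, ∀ x ∈ A t, ∀ a, (p : ℤ) ∣
      (fiberCount x a : ℤ) - fiberCount (fun k => (f₀ k).1 + t * (f₀ k).2) a)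
    {K : ℝ} (hK : 0 ≤ K)
    (htyp : ∀ t, ∀ x ∈ A t, ∀ a, |(fiberCount x a : ℝ) - n / p| ≤ K * √n)
    (hn1 : 1 ≤ n) (hn : (3 * K + 2 * p) * √n + 1 ≤ n / (p : ℝ) ^ 2) :
    (∏ t, (((A t).image fiberCount).card : ℝ)) * √n ^ (p - 1) * (p ^ 2 : ℕ) ^ n
      ≤ (progressionWords A).card * (3 ^ (p ^ 2) * √n ^ (p ^ 2 - 1)
        * exp (((p ^ 2 : ℕ) : ℝ) ^ 2 * (3 * K + 2 * p) ^ 2)) := by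
  set E : ℝ := 3 ^ (p ^ 2) * √n ^ (p ^ 2 - 1)
    * exp (((p ^ 2 : ℕ) : ℝ) ^ 2 * (3 * K + 2 * p) ^ 2) with hE
  have hm : Fintype.card (ZMod p × ZMod p) = p ^ 2 := by
    rw [Fintype.card_prod, ZMod.card, sq]
  set U := Fintype.piFinset fun t => (A t).image fiberCount with hU
  -- The value at slope 0 is pinned because `originCounts` ignores it; the other p - 1 values are
  -- free.
  set V := Fintype.piFinset fun d : ZMod p =>
    if d = 0 then {0} else Finset.range (Nat.sqrt n + 1) with hV
  have hVle : ∀ e ∈ V, ∀ d, (e d : ℝ) ≤ √n := by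
    intro e he d
    have h1 := Fintype.mem_piFinset.1 he d
    have h2 : e d ≤ Nat.sqrt n := by
      split_ifs at h1
      · simp only [Finset.mem_singleton] at h1; omega
      · simp only [Finset.mem_range] at h1; omega
    exact (Nat.cast_le.2 h2).trans Real.nat_sqrt_le_real_sqrt
  have hspec : ∀ q : U ×ˢ V, _ := fun q =>
    lineCounts_toNat_spec A f₀ hres hK htyp hn1 hn q.1.1
      (Fintype.mem_piFinset.1 (Finset.mem_product.1 q.2).1) q.1.2
      (hVle _ (Finset.mem_product.1 q.2).2)
  choose N hNeq hNpos hNsum hNmarg hNbd using hspec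
  -- The marginals recover the tuples, and the values `N (0, d)` with d ≠ 0 recover the parameters.
  have hinj : Function.Injective N := by
    intro q r hqr
    have hu : q.1.1 = r.1.1 := by
      funext t a
      rw [← hNmarg q t a, ← hNmarg r t a, hqr]
    have hv : q.1.2 = r.1.2 := by
      funext d
      by_cases hd : d = 0
      · have h1 := Fintype.mem_piFinset.1 (Finset.mem_product.1 q.2).2 d
        have h2 := Fintype.mem_piFinset.1 (Finset.mem_product.1 r.2).2 d
        simp only [hd, if_true, Finset.mem_singleton] at h1 h2
        rw [hd, h1, h2]
      · have h1 := hNeq q 0 d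
        have h2 := hNeq r 0 d
        rw [hqr, h2] at h1
        simp only [lineCounts, originCounts, sub_self, Int.zero_ediv, zero_add, if_neg hd] at h1
        omega
    exact Subtype.ext (Prod.ext hu hv)
  have hsub : (Finset.univ.biUnion fun q => Finset.univ.filter
      fun g : Fin n → ZMod p × ZMod p => fiberCount g = N q) ⊆ progressionWords A := by
    intro g hg
    simp only [Finset.mem_biUnion, Finset.mem_univ, Finset.mem_filter, true_and] at hg
    obtain ⟨q, hq⟩ := hg
    simp only [progressionWords, Finset.mem_filter, Finset.mem_univ, true_and]
    intro t
    obtain ⟨y, hy, hyu⟩ := Finset.mem_image.1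
      (Fintype.mem_piFinset.1 (Finset.mem_product.1 q.2).1 t)
    refine (hsym t y _ fun a => ?_).1 hy
    change fiberCount y a = fiberCount _ a
    rw [fiberCount_progression, hq, hNmarg, hyu]
  have hcard : ∑ q, (Finset.univ.filter
      fun g : Fin n → ZMod p × ZMod p => fiberCount g = N q).card ≤ (progressionWords A).card := by
    rw [← Finset.card_biUnion]
    · exact Finset.card_le_card hsub
    · intro q _ r _ hqr
      rw [Function.onFun, Finset.disjoint_left]
      intro g h1 h2
      exact hqr (hinj ((Finset.mem_filter.1 h1).2.symm.trans (Finset.mem_filter.1 h2).2))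
  have hclass : ∀ q, ((p ^ 2 : ℕ) : ℝ) ^ n ≤ ((Finset.univ.filter
      fun g : Fin n → ZMod p × ZMod p => fiberCount g = N q).card : ℝ) * E := by
    intro q
    have := le_card_fiberCount_eq (n := n) (N q) (hNsum q) (hNpos q) (D := 3 * K + 2 * p)
      (by rw [hm]; push_cast; exact hNbd q)
    rwa [hm] at this
  have hUcard : (U.card : ℝ) = ∏ t, (((A t).image fiberCount).card : ℝ) := by
    rw [hU, Fintype.card_piFinset]; push_cast; rfl
  have hVcard : √n ^ (p - 1) ≤ (V.card : ℝ) := by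
    rw [hV, card_pi_if_zero]
    push_cast
    gcongr
    exact Real.real_sqrt_le_nat_sqrt_succ
  calc _ ≤ (U.card : ℝ) * V.card * (p ^ 2 : ℕ) ^ n := by rw [← hUcard]; gcongr
    _ = ∑ q : U ×ˢ V, ((p ^ 2 : ℕ) : ℝ) ^ n := by
        rw [Finset.sum_const, Finset.card_univ, Fintype.card_coe, Finset.card_product,
          nsmul_eq_mul, Nat.cast_mul]
    _ ≤ ∑ q, ((Finset.univ.filter
      fun g : Fin n → ZMod p × ZMod p => fiberCount g = N q).card : ℝ) * E :=
        Finset.sum_le_sum fun q _ => hclass q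
    _ ≤ _ := by
        rw [← Finset.sum_mul]
        gcongr
        exact_mod_cast hcard

end Progressions

/-! ### From density to a polynomial lower bound. -/

section Core

open Real

theorem card_le_card_typical {p : ℕ} [Fact p.Prime] {n : ℕ} (A : Finset (Fin n → ZMod p)) {K : ℝ}
    (hK : 0 ≤ K) (hn : 0 < n) (hKn : K ≤ √n) :
    (A.card : ℝ) ≤ ((A.filter fun x => ∀ a, |(fiberCount x a : ℝ) - n / p| ≤ K * √n).card : ℝ)
      + p * (2 * (p : ℝ) ^ n * exp (-(K ^ 2 / 4))) := by
  have hsub : A ⊆ (A.filter fun x => ∀ a, |(fiberCount x a : ℝ) - n / p| ≤ K * √n) ∪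
      Finset.univ.biUnion fun a : ZMod p => Finset.univ.filter fun x : Fin n → ZMod p =>
        K * √n < |(fiberCount x a : ℝ) - n / Fintype.card (ZMod p)| := by
    intro x hx
    simp only [Finset.mem_union, Finset.mem_filter, hx, true_and, Finset.mem_biUnion,
      Finset.mem_univ, ZMod.card]
    by_contra! h
    obtain ⟨⟨a, ha⟩, h2⟩ := h
    exact absurd ha (not_lt.2 (h2 a))
  have h1 := (Nat.cast_le (α := ℝ)).2 ((Finset.card_le_card hsub).trans
    ((Finset.card_union_le _ _).trans (Nat.add_le_add_left Finset.card_biUnion_le _)))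
  rw [Nat.cast_add, Nat.cast_sum] at h1
  have h2 := Finset.sum_le_card_nsmul Finset.univ _ _ fun (a : ZMod p) _ =>
    card_fiberCount_far_le (n := n) a hK hn hKn
  rw [Finset.card_univ, nsmul_eq_mul] at h2
  rw [ZMod.card] at h1 h2
  linarith

/-- Each weight tuple accounts for few words, so a large set must contain many tuples. -/
theorem card_mul_le_card_image_fiberCount {p : ℕ} [Fact p.Prime] {n : ℕ}
    (A : Finset (Fin n → ZMod p)) (hn : 1 ≤ n / (2 * (p : ℝ)))
    (hA : ∀ x ∈ A, ∀ a, (n : ℝ) / (2 * p) ≤ fiberCount x a) :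
    (A.card : ℝ) * √n ^ (p - 1)
      ≤ (A.image fiberCount).card * (3 * √(2 * p) ^ p * (p : ℝ) ^ n) := by
  rw [Finset.card_eq_sum_card_image fiberCount, Nat.cast_sum, Finset.sum_mul, ← nsmul_eq_mul]
  refine Finset.sum_le_card_nsmul _ _ _ fun N hN => ?_
  obtain ⟨x, hx, rfl⟩ := Finset.mem_image.1 hN
  have h2 := card_fiberCount_eq_le (n := n) (fiberCount x) (sum_fiberCount x)
    (fun a => by exact_mod_cast hn.trans (hA x hx a))
    (fun a => by rw [ZMod.card]; exact hA x hx a)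
  rw [ZMod.card] at h2
  refine le_trans ?_ h2
  gcongr
  exact Finset.subset_univ _

/-- The powers of `s` = √n cancel because p(p - 1) + (p - 1) = p² - 1. -/
theorem le_of_prod_mul_pow_le {p n a : ℕ} (hp : 1 ≤ p) {s m δ C Q P X Y : ℝ} (hs : 0 < s)
    (hm : 0 < m) (hδ : 0 < δ) (hC : 0 < C) (hX : 0 < X) (hP : 0 ≤ P)
    (hQ : (δ / (2 * C) * s ^ (p - 1)) ^ p ≤ Q)
    (hQP : Q * s ^ (p - 1) * m ^ n ≤ P * (3 ^ (p ^ 2) * s ^ (p ^ 2 - 1) * Y))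
    (hY : Y ≤ X * (4 * p / δ) ^ a) :
    (1 / (2 * C)) ^ p / (3 ^ (p ^ 2) * X * (4 * p) ^ a) * δ ^ (p + a) * m ^ n ≤ P := by
  have hp0 : (0 : ℝ) < p := by exact_mod_cast hp
  obtain ⟨q, hq⟩ : ∃ q, p = q + 1 := ⟨p - 1, by omega⟩
  have hpow : (s ^ (p - 1)) ^ p * s ^ (p - 1) = s ^ (p ^ 2 - 1) := by
    rw [← pow_mul, ← pow_add]
    congr 1
    rw [hq, Nat.add_sub_cancel, show (q + 1) ^ 2 = (q * (q + 1) + q) + 1 by ring,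
      Nat.add_sub_cancel]
  have hfin : (δ / (2 * C)) ^ p * m ^ n * s ^ (p ^ 2 - 1)
      ≤ P * (3 ^ (p ^ 2) * (X * (4 * p / δ) ^ a)) * s ^ (p ^ 2 - 1) := by
    calc (δ / (2 * C)) ^ p * m ^ n * s ^ (p ^ 2 - 1)
        = (δ / (2 * C) * s ^ (p - 1)) ^ p * s ^ (p - 1) * m ^ n := by
          rw [← hpow, mul_pow]; ring
      _ ≤ Q * s ^ (p - 1) * m ^ n := by gcongr
      _ ≤ _ := hQP
      _ ≤ P * (3 ^ (p ^ 2) * s ^ (p ^ 2 - 1) * (X * (4 * p / δ) ^ a)) := by gcongr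
      _ = _ := by ring
  have hfin' := le_of_mul_le_mul_right hfin (by positivity)
  rw [← div_le_iff₀ (by positivity)] at hfin'
  refine le_trans (le_of_eq ?_) hfin'
  generalize (3 : ℝ) ^ (p ^ 2) = T
  rw [div_pow, div_pow, one_pow, div_pow, pow_add]
  field_simp

/-- Symmetric sets of density at least `δ`, each within one residue class of weights modulo `p`,
such that these residue classes occur along a progression, contain many progressions. -/
theorem exists_card_progressionWords_lower (p : ℕ) [Fact p.Prime] :
    ∃ c : ℝ, 0 < c ∧ ∃ B : ℕ, ∀ δ : ℝ, 0 < δ → δ < 1 → ∃ n₀ : ℕ, ∀ n : ℕ, n₀ ≤ n →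
      ∀ (A : ZMod p → Finset (Fin n → ZMod p)) (f₀ : Fin n → ZMod p × ZMod p),
      (∀ t, SymmetricSet (A t)) →
      (∀ t, ∀ x ∈ A t, ∀ a, (p : ℤ) ∣
        (fiberCount x a : ℤ) - fiberCount (fun k => (f₀ k).1 + t * (f₀ k).2) a) →
      (∀ t, δ * (p : ℝ) ^ n ≤ (A t).card) →
      c * δ ^ B * ((p ^ 2 : ℕ) : ℝ) ^ n ≤ (progressionWords A).card := by
  have hp1 : (1 : ℝ) ≤ p := by exact_mod_cast (Fact.out : p.Prime).one_le
  have hp2 : (2 : ℝ) ≤ p := by exact_mod_cast (Fact.out : p.Prime).two_le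
  have hp0 : (0 : ℝ) < p := by linarith
  set m : ℝ := ((p ^ 2 : ℕ) : ℝ) with hm
  set C₁ : ℝ := 3 * √(2 * p) ^ p with hC₁
  have hC₁0 : 0 < C₁ := by positivity
  refine ⟨(1 / (2 * C₁)) ^ p / (3 ^ (p ^ 2) * exp (8 * m ^ 2 * p ^ 2)
    * (4 * p) ^ (72 * (p ^ 2) ^ 2)), by positivity, p + 72 * (p ^ 2) ^ 2, ?_⟩
  intro δ hδ hδ1
  -- Then exp(-K²/4) = δ/(4p), so discarding atypical words costs at most half the density, while
  -- exp(O(K²)) remains a power of 1/δ.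
  set K : ℝ := √(4 * log (4 * p / δ)) with hK
  have hK0 : 0 ≤ K := Real.sqrt_nonneg _
  have hy1 : 1 ≤ 4 * p / δ := by rw [le_div_iff₀ hδ]; linarith
  have hy0 : 0 < 4 * p / δ := by positivity
  have hKsq : K ^ 2 = 4 * log (4 * p / δ) :=
    Real.sq_sqrt (mul_nonneg (by norm_num) (Real.log_nonneg hy1))
  set D : ℝ := 3 * K + 2 * p with hD
  have hD0 : 0 < D := by positivity
  -- This makes n / p² exceed the deviation D √n by at least 1, so all joint counts are positive.
  refine ⟨⌈((p : ℝ) ^ 2 * (D + 1)) ^ 2⌉₊ + 1, fun n hn A f₀ hsym hres hdens => ?_⟩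
  have hn1 : 1 ≤ n := by omega
  have hn0 : (0 : ℝ) < n := by exact_mod_cast hn1
  have hsn : (p : ℝ) ^ 2 * (D + 1) ≤ √n := by
    apply Real.le_sqrt_of_sq_le
    refine (Nat.le_ceil _).trans ?_
    exact_mod_cast (by omega : ⌈((p : ℝ) ^ 2 * (D + 1)) ^ 2⌉₊ ≤ n)
  have hs1 : (1 : ℝ) ≤ √n := by
    rw [Real.one_le_sqrt]; exact_mod_cast hn1
  have hss : √(n : ℝ) * √n = n := Real.mul_self_sqrt hn0.le
  have hnD : D * √n + 1 ≤ n / (p : ℝ) ^ 2 := by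
    rw [le_div_iff₀ (by positivity)]
    nlinarith [mul_le_mul_of_nonneg_right hsn (by linarith : (0 : ℝ) ≤ √n),
      mul_le_mul_of_nonneg_left hs1 (by positivity : (0 : ℝ) ≤ (p : ℝ) ^ 2)]
  have hKn : K ≤ √n := by
    have : 1 * (D + 1) ≤ (p : ℝ) ^ 2 * (D + 1) := by
      gcongr; exact one_le_pow₀ hp1
    linarith
  have hlow : n / (2 * (p : ℝ)) + K * √n ≤ n / p ∧ 1 ≤ n / (2 * (p : ℝ)) := by
    have h1 : n / (p : ℝ) ^ 2 ≤ n / (2 * p) := by gcongr; nlinarith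
    have h2 : (n : ℝ) / p = n / (2 * p) + n / (2 * p) := by field_simp; ring
    have h3 : K * √n ≤ D * √n := by gcongr; linarith
    have h4 : 0 ≤ D * √n := by positivity
    constructor <;> linarith
  set A' : ZMod p → Finset (Fin n → ZMod p) := fun t =>
    (A t).filter fun x => ∀ a, |(fiberCount x a : ℝ) - n / p| ≤ K * √n with hA'
  have hsym' : ∀ t, SymmetricSet (A' t) := by
    intro t x y hxy
    have hxy' : ∀ a, fiberCount x a = fiberCount y a := hxy
    simp only [hA', Finset.mem_filter, hsym t x y hxy, hxy']
  have hdens' : ∀ t, δ / 2 * (p : ℝ) ^ n ≤ (A' t).card := by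
    intro t
    have h1 := card_le_card_typical (A t) hK0 hn1 hKn
    have h3 : exp (-(K ^ 2 / 4)) = δ / (4 * p) := by
      rw [hKsq, mul_div_cancel_left₀ _ (by norm_num : (4 : ℝ) ≠ 0), Real.exp_neg, Real.exp_log hy0,
        inv_div]
    have h4 : (p : ℝ) * (2 * (p : ℝ) ^ n * (δ / (4 * p))) = δ / 2 * (p : ℝ) ^ n := by
      field_simp; ring
    rw [h3, h4] at h1
    have h5 := hdens t
    linarith
  have himage : ∀ t, δ / (2 * C₁) * √n ^ (p - 1) ≤ (((A' t).image fiberCount).card : ℝ) := by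
    intro t
    have h1 : ((A' t).card : ℝ) * √n ^ (p - 1)
        ≤ ((A' t).image fiberCount).card * (C₁ * (p : ℝ) ^ n) :=
      card_mul_le_card_image_fiberCount (A' t) hlow.2 fun x hx a => by
        have := (abs_le.1 ((Finset.mem_filter.1 hx).2 a)).1
        linarith [hlow.1]
    have h2 : δ / 2 * (p : ℝ) ^ n * √n ^ (p - 1)
        ≤ ((A' t).image fiberCount).card * (C₁ * (p : ℝ) ^ n) :=
      le_trans (by gcongr; exact hdens' t) h1
    have h3 : δ / 2 * √n ^ (p - 1) * (p : ℝ) ^ n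
        ≤ ((A' t).image fiberCount).card * C₁ * (p : ℝ) ^ n := by linarith
    have h4 := le_of_mul_le_mul_right h3 (by positivity)
    rw [← div_div, div_mul_eq_mul_div, div_le_iff₀ hC₁0]
    exact h4
  have hmain := card_progressionWords_ge A' hsym' f₀
    (fun t x hx => hres t x (Finset.mem_filter.1 hx).1) hK0
    (fun t x hx => (Finset.mem_filter.1 hx).2) hn1 hnD
  have hmono : ((progressionWords A').card : ℝ) ≤ (progressionWords A).card := by
    refine Nat.cast_le.2 (Finset.card_le_card fun f hf => ?_)
    simp only [progressionWords, Finset.mem_filter, Finset.mem_univ, true_and] at hf ⊢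
    exact fun t => (Finset.mem_filter.1 (hf t)).1
  have hprod : (δ / (2 * C₁) * √n ^ (p - 1)) ^ p
      ≤ ∏ t, (((A' t).image fiberCount).card : ℝ) := by
    calc _ = ∏ _t : ZMod p, (δ / (2 * C₁) * √n ^ (p - 1)) := by
          rw [Finset.prod_const, Finset.card_univ, ZMod.card]
      _ ≤ _ := Finset.prod_le_prod (fun _ _ => by positivity) fun t _ => himage t
  -- The exponent 72 is 18 · 4, from D² ≤ 18K² + 8p² and K² = 4 log(4p/δ).
  have hexp : exp (m ^ 2 * D ^ 2)
      ≤ exp (8 * m ^ 2 * p ^ 2) * (4 * p / δ) ^ (72 * (p ^ 2) ^ 2) := by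
    have h1 : (4 * p / δ) ^ (72 * (p ^ 2) ^ 2) = exp (m ^ 2 * (18 * K ^ 2)) := by
      rw [hKsq, hm, ← Real.rpow_natCast, Real.rpow_def_of_pos hy0]
      congr 1
      push_cast
      ring
    rw [h1, ← Real.exp_add, Real.exp_le_exp]
    have h2 : D ^ 2 ≤ 18 * K ^ 2 + 8 * p ^ 2 := by rw [hD]; nlinarith [sq_nonneg (3 * K - 2 * p)]
    nlinarith [mul_le_mul_of_nonneg_left h2 (sq_nonneg m)]
  refine le_trans ?_ hmono
  exact le_of_prod_mul_pow_le (Fact.out : p.Prime).one_le (by linarith)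
    (by rw [hm, Nat.cast_pow]; positivity) hδ hC₁0
    (Real.exp_pos _) (Nat.cast_nonneg _) hprod hmain hexp

end Core

/-! ### Removal of sparse residue classes. -/

section Removal

open Real

variable {p : ℕ} [Fact p.Prime] {n : ℕ}

theorem mem_progressionsIn {S : Fin p → Finset (Fin n → ZMod p)}
    {z : (Fin n → ZMod p) × (Fin n → ZMod p)} :
    z ∈ progressionsIn S ↔
      ∀ t : ZMod p, (fun k => z.1 k + t * z.2 k) ∈ S ⟨t.val, ZMod.val_lt t⟩ := by
  simp only [progressionsIn, Finset.mem_filter, Finset.mem_univ, true_and]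
  constructor
  · intro h t
    convert h ⟨t.val, ZMod.val_lt t⟩ using 1
    funext k
    rw [Pi.add_apply, Pi.smul_apply, nsmul_eq_mul, ZMod.natCast_zmod_val]
  · intro h j
    have := h ((j : ℕ) : ZMod p)
    have hj : (⟨((j : ℕ) : ZMod p).val, ZMod.val_lt _⟩ : Fin p) = j :=
      Fin.ext (ZMod.val_cast_of_lt j.2)
    rw [hj] at this
    convert this using 1
    funext k
    simp

theorem card_progressionWords_le (A : ZMod p → Finset (Fin n → ZMod p))
    (S : Fin p → Finset (Fin n → ZMod p)) (hAS : ∀ t : ZMod p, A t ⊆ S ⟨t.val, ZMod.val_lt t⟩) :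
    (progressionWords A).card ≤ (progressionsIn S).card := by
  refine Finset.card_le_card_of_injOn (fun f => (fun k => (f k).1, fun k => (f k).2)) ?_ ?_
  · intro f hf
    have hf' := (Finset.mem_filter.1 hf).2
    exact mem_progressionsIn.2 fun t => hAS t (hf' t)
  · intro f _ g _ hfg
    simp only [Prod.mk.injEq] at hfg
    funext k
    exact Prod.ext (congrFun hfg.1 k) (congrFun hfg.2 k)

/-- If removing the sparse weight residue classes leaves a progression, there were many. -/
theorem exists_removal_of_progressionProb_lt (p : ℕ) [Fact p.Prime] :
    ∃ c : ℝ, 0 < c ∧ ∃ B : ℕ, ∀ μ : ℝ, 0 < μ → μ < 1 → ∃ n₀ : ℕ, ∀ n : ℕ, n₀ ≤ n →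
      ∀ S : Fin p → Finset (Fin n → ZMod p), (∀ j, SymmetricSet (S j)) →
        progressionProb S < c * μ ^ B →
        ∃ S' : Fin p → Finset (Fin n → ZMod p),
          (∀ j, SymmetricSet (S' j)) ∧ (∀ j, density (S' j) ≤ μ) ∧
          progressionProb (fun j => S j \ S' j) = 0 := by
  have hp1 : (1 : ℝ) ≤ p := by exact_mod_cast (Fact.out : p.Prime).one_le
  have hp0 : (0 : ℝ) < p := by linarith
  obtain ⟨c, hc, B, hB⟩ := exists_card_progressionWords_lower p
  refine ⟨c * (1 / (p : ℝ) ^ p) ^ B, by positivity, B, fun μ hμ hμ1 => ?_⟩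
  -- There are at most p^p residue vectors, so classes below density δ have total density at most μ.
  set δ : ℝ := μ / (p : ℝ) ^ p with hδ
  have hδ1 : δ < 1 := by
    rw [hδ, div_lt_one (by positivity)]
    exact hμ1.trans_le (one_le_pow₀ hp1)
  obtain ⟨n₀, hn₀⟩ := hB δ (by positivity) hδ1
  refine ⟨n₀, fun n hn S hS hprob => ?_⟩
  let res : (Fin n → ZMod p) → ZMod p → ZMod p := fun x a => (fiberCount x a : ZMod p)
  have hres : ∀ x y : Fin n → ZMod p, (∀ a, weight a x = weight a y) → res x = res y :=
    fun x y h => funext fun a => congrArg Nat.cast (h a)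
  refine ⟨fun j => (S j).filter fun x =>
    (((S j).filter fun y => res y = res x).card : ℝ) < δ * (p : ℝ) ^ n, fun j x y hxy => ?_,
    fun j => ?_, ?_⟩
  · simp only [Finset.mem_filter, hS j x y hxy, hres x y hxy]
  · rw [density, div_le_iff₀ (by positivity), Finset.card_eq_sum_card_image res, Nat.cast_sum]
    refine (Finset.sum_le_card_nsmul _ _ (δ * (p : ℝ) ^ n) fun r hr => ?_).trans ?_
    · obtain ⟨x, hx, rfl⟩ := Finset.mem_image.1 hr
      refine le_trans ?_ (Finset.mem_filter.1 hx).2.le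
      exact Nat.cast_le.2 (Finset.card_le_card
        (Finset.filter_subset_filter _ (Finset.filter_subset _ _)))
    · have h1 : ∀ s : Finset (ZMod p → ZMod p), (s.card : ℝ) ≤ (p : ℝ) ^ p := fun s => by
        have := Finset.card_le_univ s
        rw [Fintype.card_fun, ZMod.card] at this
        exact_mod_cast this
      rw [nsmul_eq_mul]
      calc _ ≤ (p : ℝ) ^ p * (δ * (p : ℝ) ^ n) := by gcongr; exact h1 _
        _ = _ := by rw [hδ]; field_simp
  · by_contra hne
    have hcard : (progressionsIn fun j => S j \ (S j).filter fun x =>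
        (((S j).filter fun y => res y = res x).card : ℝ) < δ * (p : ℝ) ^ n).card ≠ 0 := by
      intro h
      apply hne
      rw [progressionProb, h]
      simp
    obtain ⟨z, hz⟩ := Finset.card_ne_zero.1 hcard
    rw [mem_progressionsIn] at hz
    simp only [Finset.mem_sdiff, Finset.mem_filter, not_and, not_lt] at hz
    -- The residue classes of the terms of the surviving progression `z`, which also serves as the
    -- witness `f₀`.
    let A : ZMod p → Finset (Fin n → ZMod p) := fun t =>
      (S ⟨t.val, ZMod.val_lt t⟩).filter fun y => res y = res fun k => z.1 k + t * z.2 k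
    have hlow := hn₀ n hn A (fun k => (z.1 k, z.2 k))
      (fun t x y hxy => by
        simp only [A, Finset.mem_filter, hS _ x y hxy, hres x y hxy])
      (fun t x hx a => by
        have h1 := congrFun (Finset.mem_filter.1 hx).2 a
        rw [← ZMod.intCast_zmod_eq_zero_iff_dvd]
        push_cast
        exact sub_eq_zero.2 h1)
      (fun t => (hz t).2 (hz t).1)
    have hle := card_progressionWords_le A S fun t => Finset.filter_subset _ _
    rw [progressionProb, div_lt_iff₀ (by positivity)] at hprob
    have h2 : c * δ ^ B * ((p ^ 2 : ℕ) : ℝ) ^ n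
        = c * (1 / (p : ℝ) ^ p) ^ B * μ ^ B * (p : ℝ) ^ (2 * n) := by
      rw [hδ, div_pow μ, div_pow 1, one_pow, pow_mul]
      push_cast
      field_simp
    have h3 : ((progressionWords A).card : ℝ) ≤ (progressionsIn S).card := by exact_mod_cast hle
    linarith

/-- Union bound: each term of a random progression is uniform, as translation by j d is a bijection
for fixed d. -/
theorem one_sub_le_progressionProb (S : Fin p → Finset (Fin n → ZMod p)) {μ : ℝ}
    (hS : ∀ j, μ ≤ density (S j)) : 1 - p * (1 - μ) ≤ progressionProb S := by
  have hp0 : (0 : ℝ) < p := by exact_mod_cast (Fact.out : p.Prime).pos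
  have hmiss : ∀ j : Fin p, ((Finset.univ.filter fun z : (Fin n → ZMod p) × (Fin n → ZMod p) =>
      z.1 + (j : ℕ) • z.2 ∉ S j).card : ℝ) ≤ (1 - μ) * (p : ℝ) ^ (2 * n) := by
    intro j
    have h1 : (Finset.univ.filter fun z : (Fin n → ZMod p) × (Fin n → ZMod p) =>
      z.1 + (j : ℕ) • z.2 ∉ S j).card
        ≤ ((S j)ᶜ ×ˢ (Finset.univ : Finset (Fin n → ZMod p))).card := by
      refine Finset.card_le_card_of_injOn (fun z => (z.1 + (j : ℕ) • z.2, z.2)) ?_ ?_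
      · intro z hz
        simpa using hz
      · intro z _ z' _ h
        simp only [Prod.mk.injEq] at h
        refine Prod.ext ?_ h.2
        have := h.1
        rw [h.2] at this
        exact add_right_cancel this
    rw [Finset.card_product, Finset.card_compl, Finset.card_univ, Fintype.card_fun, ZMod.card,
      Fintype.card_fin] at h1
    have hle : (S j).card ≤ p ^ n := by
      have := Finset.card_le_univ (S j)
      rwa [Fintype.card_fun, ZMod.card, Fintype.card_fin] at this
    have h2 := (Nat.cast_le (α := ℝ)).2 h1
    push_cast [Nat.cast_sub hle] at h2
    have h3 := hS j
    rw [density, le_div_iff₀ (by positivity)] at h3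
    calc _ ≤ _ := h2
      _ ≤ ((p : ℝ) ^ n - μ * (p : ℝ) ^ n) * (p : ℝ) ^ n := by gcongr
      _ = _ := by rw [two_mul, pow_add]; ring
  have hcover : (Finset.univ : Finset ((Fin n → ZMod p) × (Fin n → ZMod p))) ⊆
      progressionsIn S ∪ Finset.univ.biUnion fun j : Fin p =>
        Finset.univ.filter fun z : (Fin n → ZMod p) × (Fin n → ZMod p) =>
          z.1 + (j : ℕ) • z.2 ∉ S j := by
    intro z _
    simp only [progressionsIn, Finset.mem_union, Finset.mem_filter, Finset.mem_univ, true_and,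
      Finset.mem_biUnion]
    by_contra! h
    obtain ⟨⟨j, hj⟩, h2⟩ := h
    exact hj (h2 j)
  have h1 := (Nat.cast_le (α := ℝ)).2 ((Finset.card_le_card hcover).trans
    ((Finset.card_union_le _ _).trans (Nat.add_le_add_left Finset.card_biUnion_le _)))
  rw [Nat.cast_add, Nat.cast_sum, Finset.card_univ, Fintype.card_prod, Fintype.card_fun,
    ZMod.card, Fintype.card_fin] at h1
  have h2 := Finset.sum_le_card_nsmul Finset.univ _ _ fun (j : Fin p) _ => hmiss j
  rw [Finset.card_univ, Fintype.card_fin, nsmul_eq_mul] at h2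
  rw [progressionProb, le_div_iff₀ (by positivity)]
  have h3 : ((p ^ n * p ^ n : ℕ) : ℝ) = (p : ℝ) ^ (2 * n) := by
    push_cast; rw [two_mul, pow_add]
  rw [h3] at h1
  linarith

/-- Deleting one whole set kills everything; this serves μ close to 1, where the constant c cannot
be absorbed into a power of μ. -/
theorem exists_removal_of_density_le (S : Fin p → Finset (Fin n → ZMod p))
    (hS : ∀ j, SymmetricSet (S j)) {μ : ℝ} (hμ : 0 ≤ μ) (j : Fin p) (hj : density (S j) ≤ μ) :
    ∃ S' : Fin p → Finset (Fin n → ZMod p),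
      (∀ j, SymmetricSet (S' j)) ∧ (∀ j, density (S' j) ≤ μ) ∧
      progressionProb (fun j => S j \ S' j) = 0 := by
  refine ⟨fun i => if i = j then S j else ∅, fun i => ?_, fun i => ?_, ?_⟩
  · dsimp only
    split_ifs
    · exact hS j
    · intro x y _; simp
  · dsimp only
    split_ifs
    · exact hj
    · simpa [density] using hμ
  · have : progressionsIn (fun i => S i \ if i = j then S j else ∅) = ∅ := by
      rw [Finset.eq_empty_iff_forall_notMem]
      intro z hz
      have := (Finset.mem_filter.1 hz).2 j
      simp at this
    rw [progressionProb, this]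
    simp

/-- With ε = 1 - μ, compare both sides after multiplying by 1 + M ε: Bernoulli bounds the left by (1
- ε²)^M ≤ 1, and pε ≤ 1/2 with M ≥ 2p makes the right at least 1. -/
theorem pow_le_one_sub_mul {p M : ℕ} {μ : ℝ} (hp : 1 ≤ p) (hμ : 1 - 1 / (2 * p) ≤ μ)
    (hμ1 : μ ≤ 1) (hM : 2 * p ≤ M) : μ ^ M ≤ 1 - p * (1 - μ) := by
  have hp1 : (1 : ℝ) ≤ p := by exact_mod_cast hp
  have hM' : 2 * (p : ℝ) ≤ M := by exact_mod_cast hM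
  obtain ⟨ε, rfl⟩ : ∃ ε, μ = 1 - ε := ⟨1 - μ, by ring⟩
  have hε0 : 0 ≤ ε := by linarith
  have hε : ε * p ≤ 1 / 2 := by
    have : ε ≤ 1 / (2 * p) := by linarith
    calc ε * p ≤ 1 / (2 * p) * p := by gcongr
      _ = 1 / 2 := by field_simp
  have hε1 : ε ≤ 1 := by nlinarith
  have h1 : (1 - ε) ^ M * (1 + M * ε) ≤ 1 := by
    calc (1 - ε) ^ M * (1 + M * ε) ≤ (1 - ε) ^ M * (1 + ε) ^ M := by
          have : 0 ≤ (1 - ε) ^ M := pow_nonneg (by linarith) M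
          gcongr
          exact one_add_mul_le_pow (by linarith) M
      _ = ((1 - ε) * (1 + ε)) ^ M := (mul_pow _ _ _).symm
      _ ≤ 1 := pow_le_one₀ (mul_nonneg (by linarith) (by linarith)) (by nlinarith)
  have h2 : 1 ≤ (1 - p * ε) * (1 + M * ε) := by
    have : (ε * p) * (M * ε) ≤ 1 / 2 * (M * ε) := by gcongr
    nlinarith [mul_le_mul_of_nonneg_right hM' hε0]
  have h3 : 0 < 1 + M * ε := by positivity
  rw [sub_sub_cancel]
  exact le_of_mul_le_mul_right (h1.trans h2) h3

/-- The removal property with polynomial dependence. -/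
theorem exists_removal_exponent (p : ℕ) [Fact p.Prime] :
    ∃ M : ℕ, 0 < M ∧ ∀ μ : ℝ, 0 < μ → μ < 1 → ∃ n₀ : ℕ, ∀ n : ℕ, n₀ ≤ n →
      ∀ S : Fin p → Finset (Fin n → ZMod p), (∀ j, SymmetricSet (S j)) →
        progressionProb S < μ ^ M →
        ∃ S' : Fin p → Finset (Fin n → ZMod p),
          (∀ j, SymmetricSet (S' j)) ∧ (∀ j, density (S' j) ≤ μ) ∧
          progressionProb (fun j => S j \ S' j) = 0 := by
  have hp : 1 ≤ p := (Fact.out : p.Prime).one_le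
  have hp1 : (1 : ℝ) ≤ p := by exact_mod_cast hp
  obtain ⟨c, hc, B, hB⟩ := exists_removal_of_progressionProb_lt p
  have hθ1 : 1 - 1 / (2 * (p : ℝ)) < 1 := by
    have : 0 < 1 / (2 * (p : ℝ)) := by positivity
    linarith
  obtain ⟨k, hk⟩ := exists_pow_lt_of_lt_one hc hθ1
  -- The summand k absorbs c for μ ≤ 1 - 1/(2p); the summand 2p serves larger μ.
  refine ⟨B + k + 2 * p, by omega, fun μ hμ hμ1 => ?_⟩
  obtain ⟨n₀, hn₀⟩ := hB μ hμ hμ1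
  refine ⟨n₀, fun n hn S hS hprob => ?_⟩
  rcases le_total μ (1 - 1 / (2 * (p : ℝ))) with h | h
  · refine hn₀ n hn S hS (hprob.trans_le ?_)
    calc μ ^ (B + k + 2 * p) = μ ^ B * μ ^ k * μ ^ (2 * p) := by rw [pow_add, pow_add]
      _ ≤ μ ^ B * c * 1 := by
        gcongr
        · exact (pow_le_pow_left₀ hμ.le h k).trans hk.le
        · exact pow_le_one₀ hμ.le hμ1.le
      _ = c * μ ^ B := by ring
  · by_cases hex : ∃ j, density (S j) ≤ μ
    · obtain ⟨j, hj⟩ := hex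
      exact exists_removal_of_density_le S hS hμ.le j hj
    · push Not at hex
      have h1 := one_sub_le_progressionProb S fun j => (hex j).le
      have h2 := pow_le_one_sub_mul hp h hμ1.le (M := B + k + 2 * p) (by omega)
      linarith

/-- The removed sets together have density at most μ/2, so some point of `S` avoids them all and
gives a progression with d = 0. -/
theorem progressionProb_sdiff_ne_zero (S : Finset (Fin n → ZMod p))
    (S' : Fin p → Finset (Fin n → ZMod p)) {μ : ℝ} (hμ : 0 < μ) (hS : μ ≤ density S)
    (hS' : ∀ j, density (S' j) ≤ μ / (2 * p)) :
    progressionProb (fun j => S \ S' j) ≠ 0 := by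
  have hp0 : (0 : ℝ) < p := by exact_mod_cast (Fact.out : p.Prime).pos
  have hpn : (0 : ℝ) < (p : ℝ) ^ n := by positivity
  have hex : ∃ x ∈ S, x ∉ Finset.univ.biUnion S' := by
    apply Finset.exists_mem_notMem_of_card_lt_card
    have h1 : ((Finset.univ.biUnion S').card : ℝ) ≤ ∑ j, ((S' j).card : ℝ) := by
      exact_mod_cast Finset.card_biUnion_le
    have h2 := Finset.sum_le_card_nsmul Finset.univ (fun j => ((S' j).card : ℝ))
      (μ / (2 * p) * (p : ℝ) ^ n) fun j _ => (div_le_iff₀ hpn).1 (hS' j)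
    rw [Finset.card_univ, Fintype.card_fin, nsmul_eq_mul] at h2
    have h3 : (p : ℝ) * (μ / (2 * p) * (p : ℝ) ^ n) = μ / 2 * (p : ℝ) ^ n := by field_simp
    have h4 : μ * (p : ℝ) ^ n ≤ S.card := (le_div_iff₀ hpn).1 hS
    have h5 : 0 < μ * (p : ℝ) ^ n := by positivity
    have : ((Finset.univ.biUnion S').card : ℝ) < S.card := by linarith
    exact_mod_cast this
  obtain ⟨x, hxS, hx⟩ := hex
  have hmem : (x, 0) ∈ progressionsIn fun j => S \ S' j := by
    simp only [progressionsIn, Finset.mem_filter, Finset.mem_univ, true_and, smul_zero, add_zero,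
      Finset.mem_sdiff]
    exact fun j => ⟨hxS, fun h => hx (Finset.mem_biUnion.2 ⟨j, Finset.mem_univ _, h⟩)⟩
  have hpos := Finset.card_pos.2 ⟨_, hmem⟩
  rw [progressionProb]
  have : (0 : ℝ) < (progressionsIn fun j => S \ S' j).card := by exact_mod_cast hpos
  positivity

end Removal

/-! ### The main theorem. -/

theorem theorem1 (p : ℕ) [Fact p.Prime] (hp : 3 ≤ p) :
    ∃ C : ℝ, 0 < C ∧ ∀ μ : ℝ, 0 < μ → μ < 1 → ∃ n₀ : ℕ, ∀ n : ℕ, n₀ ≤ n →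
      (∀ S : Fin p → Finset (Fin n → ZMod p), (∀ j, SymmetricSet (S j)) →
        progressionProb S < μ ^ C →
        ∃ S' : Fin p → Finset (Fin n → ZMod p),
          (∀ j, SymmetricSet (S' j)) ∧ (∀ j, density (S' j) ≤ μ) ∧
          progressionProb (fun j => S j \ S' j) = 0) ∧
      (∀ S : Finset (Fin n → ZMod p), SymmetricSet S → μ ≤ density S →
        (μ / p) ^ C * (p : ℝ) ^ (2 * n) ≤ ((progressionsIn fun _ : Fin p => S).card : ℝ)) := by
  have hp3 : (3 : ℝ) ≤ p := by exact_mod_cast hp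
  have hp0 : (0 : ℝ) < p := by linarith
  obtain ⟨M, hM, hrem⟩ := exists_removal_exponent p
  -- The second statement applies removal at μ/(2p), and (μ/p)² ≤ μ/(2p) explains the doubling.
  refine ⟨((2 * M : ℕ) : ℝ), by positivity, fun μ hμ hμ1 => ?_⟩
  have hν : μ / (2 * p) < 1 := by rw [div_lt_one (by positivity)]; linarith
  obtain ⟨n₁, hn₁⟩ := hrem μ hμ hμ1
  obtain ⟨n₂, hn₂⟩ := hrem (μ / (2 * p)) (by positivity) hν
  refine ⟨max n₁ n₂, fun n hn => ⟨fun S hS hprob => ?_, fun S hS hdens => ?_⟩⟩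
  · refine hn₁ n (le_of_max_le_left hn) S hS (hprob.trans_le ?_)
    rw [Real.rpow_natCast]
    exact pow_le_pow_of_le_one hμ.le hμ1.le (by omega)
  · by_contra! hlt
    rw [Real.rpow_natCast, ← div_lt_iff₀ (by positivity)] at hlt
    have hle : (μ / p) ^ (2 * M) ≤ (μ / (2 * p)) ^ M := by
      rw [pow_mul]
      refine pow_le_pow_left₀ (by positivity) ?_ M
      rw [div_pow, div_le_div_iff₀ (by positivity) (by positivity)]
      have : 0 < μ * p := by positivity
      nlinarith
    obtain ⟨S', -, hS', hzero⟩ := hn₂ n (le_of_max_le_right hn) (fun _ => S) (fun _ => hS)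
      (lt_of_lt_of_le hlt hle)
    exact progressionProb_sdiff_ne_zero S S' hμ hdens hS' hzero
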